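/- Let $\alpha\in(1,2)$ and let $X$ be the totally asymmetric strictly $\alpha$-stable random variable with characteristic function $$\mathbb{E}\exp(itX)=\exp\left(\int_0^{\infty}\left(e^{itx}-1-itx\right)\frac{dx}{x^{\alpha+1}}\right),\qquad t\in\mathbb{R}.$$ For every $y\in\left[\frac{2}{\sqrt{2-\alpha}},\frac{2}{2-\alpha}\right]$ one has $$\mathbb{P}\left(X\le -y-\frac{1}{\alpha-1}\right)\le e^{4/3}e^{-\frac12(2-\alpha)y^2},$$ $$\mathbb{P}\left(X\le -\frac{1}{24}y-\frac{1}{\alpha-1}\right)\ge e^{-1}10^{-2}e^{-(2-\alpha)y^2}.$$ For every $y\ge\frac{2}{2-\alpha}$ one has $$\mathbb{P}\left(X\le -y-\frac{1}{\alpha-1}\right)\le\exp\left(-\frac{\left(\frac12\left(y+\frac{1}{\alpha-1}\right)\right)^{\alpha/(\alpha-1)}}{\left(\frac{1}{2-\alpha}+\frac{1}{\alpha-1}\right)^{1/(\alpha-1)}}\right),$$ $$\mathbb{P}\left(X\le -\left(\frac1e-\frac14\right)y-\frac{1}{\alpha-1}\right)\ge e^{-1}\exp\left(-\frac{\left(\sqrt{4-\frac2e}\left(y+\frac{1}{\alpha-1}\right)\right)^{\alpha/(\alpha-1)}}{\left(\frac{1}{2-\alpha}+\frac{1}{\alpha-1}\right)^{1/(\alpha-1)}}\right).$$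 -/

import Mathlib

open MeasureTheory ProbabilityTheory

/-- The characteristic exponent `∫₀^∞ (e^{itx} - 1 - itx) dx / x^{α+1}` of the strictly `α`-stable,
totally asymmetric law, `1 < α < 2`, whose Lévy measure is `x^{-α-1} dx` on `(0, ∞)`. -/
noncomputable def stableExponent (α t : ℝ) : ℂ :=
  ∫ x in Set.Ioi (0 : ℝ),
    (Complex.exp (Complex.I * t * x) - 1 - Complex.I * t * x) / ((x ^ (α + 1) : ℝ) : ℂ)

/-- `X` is a random variable on `(Ω, P)` with characteristic function
`E exp(itX) = exp(∫₀^∞ (e^{itx} - 1 - itx) dx / x^{α+1})`. -/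
structure IsTotallyAsymmetricStable {Ω : Type*} [MeasurableSpace Ω] (α : ℝ) (X : Ω → ℝ)
    (P : Measure Ω) : Prop where
  aemeasurable : AEMeasurable X P
  charFun_eq : ∀ t : ℝ, charFun (P.map X) t = Complex.exp (stableExponent α t)

/-! Everything rests on the Laplace transform `E exp(-sX) = exp(ψ(s))` for `s > 0`, with `ψ(s) =
∫₀^∞ (e^{-sx} - 1 + sx) x^{-α-1} dx`. The hypothesis gives only the characteristic function; its
formula extends analytically to `0 < re z` and is bounded on each strip `0 ≤ re z ≤ s`. A contour
shift with a Gaussian regularizer then identifies the transform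
(`integrable_exp_and_integral_exp_of_charFun_eq`).

Upper tails follow from Chernoff: `P(X ≤ -w) ≤ exp(ψ(s) - sw)`. Lower tails follow from
Paley–Zygmund for `exp(-sX)`: if `sw + c ≤ ψ(s)`, then `P(X ≤ -w) ≥ (1 - e^{-c})² exp(-(ψ(2s) -
2ψ(s)))`.

Two descriptions of `ψ` are used. Splitting the integral at `x = 1` gives `ψ(s) ≈ s²/(2(2-α)) +
s/(α-1)`; the linear term matches the shift `1/(α-1)` in the thresholds, and `s = (2-α)y` yields the
Gaussian regime. Exactly, `ψ(s) = κ s^α`, where `κ = ψ(1)` lies between `(4/5)D/α` and `D/α`, `D =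
1/(2-α) + 1/(α-1)`. Choosing `s^{α-1}` proportional to `(y + 1/(α-1))/D` yields the regime with
exponent `α/(α-1)`. -/

/-! ### Laplace transforms from analytic extensions of characteristic functions. -/

open Filter Topology in
/-- Shift of a contour across a vertical strip, for a function with Gaussian decay. -/
theorem integral_vertical_line_eq_of_gaussian_decay {F : ℂ → ℂ} {s B b : ℝ} (hs : 0 ≤ s)
    (hb : 0 < b) (hc : ContinuousOn F {z | 0 ≤ z.re ∧ z.re ≤ s})
    (hd : DifferentiableOn ℂ F {z | 0 < z.re ∧ z.re < s})
    (hB : ∀ z : ℂ, 0 ≤ z.re → z.re ≤ s → ‖F z‖ ≤ B * Real.exp (-b * z.im ^ 2)) :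
    ∫ τ : ℝ, F (τ * Complex.I) = ∫ τ : ℝ, F (s + τ * Complex.I) := by
  have hline : ∀ σ : ℝ, 0 ≤ σ → σ ≤ s → Integrable (fun τ : ℝ => F (σ + τ * Complex.I)) := by
    intro σ h0 h1
    refine Integrable.mono' ((integrable_exp_neg_mul_sq hb).const_mul B) ?_ ?_
    · refine Continuous.aestronglyMeasurable ?_
      refine hc.comp_continuous (by fun_prop) (fun τ => ?_)
      simp [h0, h1]
    · refine Eventually.of_forall fun τ => ?_
      simpa using hB (σ + τ * Complex.I) (by simpa using h0) (by simpa using h1)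
  have hI0 := hline 0 le_rfl hs
  have hIs := hline s hs le_rfl
  simp only [Complex.ofReal_zero, zero_add] at hI0
  have L0 := intervalIntegral_tendsto_integral hI0 tendsto_neg_atTop_atBot tendsto_id
  have Ls := intervalIntegral_tendsto_integral hIs tendsto_neg_atTop_atBot tendsto_id
  have hdecay : Tendsto (fun T : ℝ => B * Real.exp (-b * T ^ 2) * |s - 0|) atTop (𝓝 0) := by
    have : Tendsto (fun T : ℝ => Real.exp (-b * T ^ 2)) atTop (𝓝 0) :=
      Real.tendsto_exp_atBot.comp
        ((tendsto_pow_atTop two_ne_zero).const_mul_atTop_of_neg (neg_lt_zero.mpr hb))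
    simpa using (this.const_mul B).mul_const |s - 0|
  have hside : ∀ T : ℝ, ‖∫ σ : ℝ in (0 : ℝ)..s, F (σ + T * Complex.I)‖ ≤
      B * Real.exp (-b * T ^ 2) * |s - 0| := by
    intro T
    refine intervalIntegral.norm_integral_le_of_norm_le_const fun σ hσ => ?_
    rw [Set.uIoc_of_le hs] at hσ
    simpa using hB (σ + T * Complex.I) (by simpa using hσ.1.le) (by simpa using hσ.2)
  have Htop : Tendsto (fun T : ℝ => ∫ σ : ℝ in (0 : ℝ)..s, F (σ + T * Complex.I)) atTop (𝓝 0) :=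
    squeeze_zero_norm hside hdecay
  have Hbot : Tendsto (fun T : ℝ => ∫ σ : ℝ in (0 : ℝ)..s, F (σ + (-T : ℝ) * Complex.I)) atTop
      (𝓝 0) := by
    refine squeeze_zero_norm (fun T => ?_) hdecay
    simpa using hside (-T)
  have hrect : ∀ T : ℝ, 0 ≤ T →
      (∫ σ : ℝ in (0 : ℝ)..s, F (σ + (-T : ℝ) * Complex.I)) -
        (∫ σ : ℝ in (0 : ℝ)..s, F (σ + T * Complex.I)) +
        Complex.I * (∫ τ : ℝ in (-T)..T, F (s + τ * Complex.I)) -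
        Complex.I * (∫ τ : ℝ in (-T)..T, F (τ * Complex.I)) = 0 := by
    intro T hT
    have h := Complex.integral_boundary_rect_eq_zero_of_continuousOn_of_differentiableOn F
      (⟨0, -T⟩ : ℂ) (⟨s, T⟩ : ℂ) (hc.mono ?_) (hd.mono ?_)
    · simpa using h
    · intro z hz
      rw [Complex.mem_reProdIm] at hz
      have := hz.1
      simpa [Set.uIcc_of_le hs] using this
    · intro z hz
      rw [Complex.mem_reProdIm] at hz
      have := hz.1
      simpa [hs] using this
  have hlim := ((Hbot.sub Htop).add (Ls.const_mul Complex.I)).sub (L0.const_mul Complex.I)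
  have hzero := tendsto_nhds_unique (hlim.congr' (f₂ := fun _ => (0 : ℂ))
    ((eventually_ge_atTop 0).mono fun T hT => by simpa using hrect T hT)) tendsto_const_nhds
  have : Complex.I * ((∫ τ : ℝ, F (s + τ * Complex.I)) - ∫ τ : ℝ, F (τ * Complex.I)) = 0 := by
    linear_combination hzero
  rcases mul_eq_zero.mp this with h | h
  · exact absurd h Complex.I_ne_zero
  · exact (sub_eq_zero.mp h).symm

/-- A Gaussian-weighted exponential as a superposition of characters. -/
theorem integral_cexp_neg_mul_I_mul_gaussian {b : ℝ} (hb : 0 < b) (s x : ℝ) :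
    ∫ τ : ℝ, Complex.exp (-(τ * Complex.I) * x) *
        Complex.exp (b * ((τ : ℂ) * Complex.I - s) ^ 2) =
      (Real.sqrt (Real.pi / b) : ℂ) * (Real.exp (-s * x - x ^ 2 / (4 * b)) : ℝ) := by
  have h := integral_cexp_quadratic (b := (-b : ℂ)) (by simpa using hb)
    (-(Complex.I * (x + 2 * b * s))) (b * s ^ 2)
  have hI := Complex.I_sq
  rw [show (fun τ : ℝ => Complex.exp (-(τ * Complex.I) * x) *
        Complex.exp (b * ((τ : ℂ) * Complex.I - s) ^ 2)) = fun τ : ℝ =>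
        Complex.exp (-b * τ ^ 2 + -(Complex.I * (x + 2 * b * s)) * τ + b * s ^ 2) by
      funext τ
      rw [← Complex.exp_add]
      congr 1
      linear_combination (b * τ ^ 2 : ℂ) * hI]
  rw [h]
  congr 1
  · rw [neg_neg, Real.sqrt_eq_rpow, Complex.ofReal_cpow (by positivity)]
    push_cast
    rfl
  · rw [Complex.ofReal_exp]
    congr 1
    have hb' : (b : ℂ) ≠ 0 := by exact_mod_cast hb.ne'
    push_cast
    field_simp
    linear_combination ((x + 2 * b * s) ^ 2 : ℂ) * hI

/-- Gaussian regularization of the Laplace transform of a measure whose characteristic function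
extends to a bounded analytic function on a strip. -/
theorem integral_exp_neg_mul_gaussian_of_charFun_eq {μ : Measure ℝ} [IsProbabilityMeasure μ]
    {G : ℂ → ℂ} {s B b : ℝ} (hs : 0 ≤ s) (hb : 0 < b)
    (hc : ContinuousOn G {z | 0 ≤ z.re ∧ z.re ≤ s})
    (hd : DifferentiableOn ℂ G {z | 0 < z.re ∧ z.re < s})
    (hB : ∀ z : ℂ, 0 ≤ z.re → z.re ≤ s → ‖G z‖ ≤ B)
    (hG : ∀ t : ℝ, charFun μ t = G (-(t * Complex.I))) :
    (Real.sqrt (Real.pi / b) : ℂ) * (∫ x, Real.exp (-s * x - x ^ 2 / (4 * b)) ∂μ : ℝ) =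
      ∫ τ : ℝ, G (s + τ * Complex.I) * Real.exp (-b * τ ^ 2) := by
  have hB0 : 0 ≤ B := (norm_nonneg _).trans (hB 0 (by simp) (by simpa using hs))
  have hgauss : ∀ z : ℂ, ‖Complex.exp (b * (z - s) ^ 2)‖ =
      Real.exp (b * (z.re - s) ^ 2) * Real.exp (-b * z.im ^ 2) := by
    intro z
    rw [Complex.norm_exp, ← Real.exp_add]
    congr 1
    simp [sq]
    ring
  have hint : Integrable (fun p : ℝ × ℝ => Complex.exp (-(p.2 * Complex.I) * p.1) *
      Complex.exp (b * ((p.2 : ℂ) * Complex.I - s) ^ 2)) (μ.prod volume) := by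
    refine Integrable.mono' ((integrable_const (Real.exp (b * s ^ 2))).mul_prod
      (integrable_exp_neg_mul_sq hb)) (by fun_prop) (Filter.Eventually.of_forall fun p => ?_)
    rw [norm_mul, hgauss, Complex.norm_exp]
    simp
  have hfub := integral_integral_swap
    (f := fun (x : ℝ) (τ : ℝ) => Complex.exp (-(τ * Complex.I) * x) *
      Complex.exp (b * ((τ : ℂ) * Complex.I - s) ^ 2)) hint
  simp_rw [integral_cexp_neg_mul_I_mul_gaussian hb s] at hfub
  rw [integral_const_mul, integral_complex_ofReal] at hfub
  rw [hfub]
  have hinner : ∀ τ : ℝ, ∫ x : ℝ, Complex.exp (-(τ * Complex.I) * x) *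
      Complex.exp (b * ((τ : ℂ) * Complex.I - s) ^ 2) ∂μ =
      G (τ * Complex.I) * Complex.exp (b * ((τ : ℂ) * Complex.I - s) ^ 2) := by
    intro τ
    rw [integral_mul_const]
    congr 1
    have := hG (-τ)
    rw [charFun_apply_real] at this
    simp only [Complex.ofReal_neg, neg_mul, neg_neg] at this
    rw [← this]
    congr 1
    funext x
    congr 1
    ring
  simp_rw [hinner]
  -- The factor `exp(b(z - s)²)` is entire, decays like a Gaussian along vertical lines, and becomes
  -- the real weight `exp(-bτ²)` on `re z = s`.
  rw [integral_vertical_line_eq_of_gaussian_decay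
    (F := fun z => G z * Complex.exp (b * (z - s) ^ 2)) (B := B * Real.exp (b * s ^ 2)) hs hb
    (hc.mul (by fun_prop)) (hd.mul (by fun_prop))]
  · congr 1
    funext τ
    rw [Complex.ofReal_exp]
    congr 2
    push_cast
    linear_combination (b * τ ^ 2 : ℂ) * Complex.I_sq
  · intro z h0 h1
    rw [norm_mul, hgauss, mul_assoc]
    have hsq : (z.re - s) ^ 2 ≤ s ^ 2 := by nlinarith
    gcongr ?_ * (Real.exp (b * ?_) * _)
    · exact hB z h0 h1

open Filter Topology in
/-- If the characteristic function of `μ` extends to a bounded function on the strip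
`0 ≤ re z ≤ s`, analytic inside, then the extension computes the Laplace transform at `s`. -/
theorem integrable_exp_and_integral_exp_of_charFun_eq {μ : Measure ℝ} [IsProbabilityMeasure μ]
    {G : ℂ → ℂ} {s B : ℝ} (hs : 0 ≤ s)
    (hc : ContinuousOn G {z | 0 ≤ z.re ∧ z.re ≤ s})
    (hd : DifferentiableOn ℂ G {z | 0 < z.re ∧ z.re < s})
    (hB : ∀ z : ℂ, 0 ≤ z.re → z.re ≤ s → ‖G z‖ ≤ B)
    (hG : ∀ t : ℝ, charFun μ t = G (-(t * Complex.I))) :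
    Integrable (fun x => Real.exp (-s * x)) μ ∧ ∫ x, Real.exp (-s * x) ∂μ = (G s).re := by
  -- The regularizer has `b = (n+1)²`: in `x` it increases to `1`, while the dual Gaussian in `τ`
  -- concentrates at `0`, so the contour integral tends to a multiple of `G s`.
  set f : ℕ → ℝ → ℝ := fun n x => Real.exp (-s * x - x ^ 2 / (4 * ((n : ℝ) + 1) ^ 2)) with hf
  have hreg : ∀ n : ℕ, (Real.sqrt Real.pi : ℂ) * (∫ x, f n x ∂μ : ℝ) =
      ∫ u : ℝ, G (s + ((u / ((n : ℝ) + 1) : ℝ) : ℂ) * Complex.I) * Real.exp (-1 * u ^ 2) := by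
    intro n
    have hn : (0 : ℝ) < (n : ℝ) + 1 := by positivity
    have h := integral_exp_neg_mul_gaussian_of_charFun_eq (b := ((n : ℝ) + 1) ^ 2) hs
      (by positivity) hc hd hB hG
    have hsub := Measure.integral_comp_div (fun τ : ℝ => G (s + (τ : ℂ) * Complex.I) *
      (Real.exp (-((n : ℝ) + 1) ^ 2 * τ ^ 2) : ℂ)) ((n : ℝ) + 1)
    rw [← h, abs_of_pos hn, Real.sqrt_div Real.pi_pos.le, Real.sqrt_sq hn.le] at hsub
    have hne : ((n : ℂ) + 1) ≠ 0 := by exact_mod_cast hn.ne'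
    rw [Complex.real_smul] at hsub
    push_cast at hsub
    rw [← mul_assoc, mul_div_cancel₀ _ hne] at hsub
    rw [← hsub]
    congr 1
    funext u
    rw [Complex.ofReal_exp]
    congr 2
    · push_cast
      rfl
    · push_cast
      field_simp
  have hre : ∀ r : ℝ, ((s : ℂ) + (r : ℂ) * Complex.I).re = s := fun r => by simp
  have hexp : Integrable (fun u : ℝ => Real.exp (-1 * u ^ 2)) := integrable_exp_neg_mul_sq one_pos
  have hlim : Tendsto (fun n : ℕ => ∫ u : ℝ, G (s + ((u / ((n : ℝ) + 1) : ℝ) : ℂ) * Complex.I) *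
      Real.exp (-1 * u ^ 2)) atTop (𝓝 (∫ u : ℝ, G s * Real.exp (-1 * u ^ 2))) := by
    refine tendsto_integral_of_dominated_convergence (fun u => B * Real.exp (-1 * u ^ 2))
      (fun n => ?_) (hexp.const_mul B) (fun n => Eventually.of_forall fun u => ?_)
      (Eventually.of_forall fun u => ?_)
    · refine Continuous.aestronglyMeasurable (Continuous.mul ?_ (by fun_prop))
      refine hc.comp_continuous (by fun_prop) fun u => ?_
      exact ⟨hs.trans_eq (hre _).symm, (hre _).le⟩
    · rw [norm_mul, Complex.norm_real, Real.norm_of_nonneg (Real.exp_pos _).le]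
      gcongr
      exact hB _ (hs.trans_eq (hre _).symm) (hre _).le
    · refine Tendsto.mul_const _ ?_
      have h1 : Tendsto (fun n : ℕ => (s : ℂ) + ((u / ((n : ℝ) + 1) : ℝ) : ℂ) * Complex.I) atTop
          (𝓝 (s : ℂ)) := by
        have : Tendsto (fun n : ℕ => u / ((n : ℝ) + 1)) atTop (𝓝 0) :=
          tendsto_const_nhds.div_atTop
            (tendsto_atTop_add_const_right _ _ tendsto_natCast_atTop_atTop)
        have := (Complex.continuous_ofReal.tendsto 0).comp this
        simpa using (this.mul_const Complex.I).const_add (s : ℂ)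
      refine (hc s (by simpa using hs)).tendsto.comp
        (tendsto_nhdsWithin_iff.mpr ⟨h1, Eventually.of_forall fun n => ?_⟩)
      exact ⟨hs.trans_eq (hre _).symm, (hre _).le⟩
  have hgint : ∫ u : ℝ, G s * (Real.exp (-1 * u ^ 2) : ℂ) = Real.sqrt Real.pi * G s := by
    rw [integral_const_mul, integral_complex_ofReal, integral_gaussian, div_one, mul_comm]
  rw [hgint] at hlim
  have hpi : (Real.sqrt Real.pi) ≠ 0 := (Real.sqrt_pos.mpr Real.pi_pos).ne'
  have hpi' : (Real.sqrt Real.pi : ℂ) ≠ 0 := by exact_mod_cast hpi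
  have hL : Tendsto (fun n => ∫ x, f n x ∂μ) atTop (𝓝 (G s).re) := by
    have h1 := (hlim.congr fun n => (hreg n).symm).const_mul (Real.sqrt Real.pi : ℂ)⁻¹
    simp only [inv_mul_cancel_left₀ hpi'] at h1
    exact (Complex.continuous_re.tendsto _).comp h1
  have hfint : ∀ n, Integrable (f n) μ := by
    intro n
    have hn : (0 : ℝ) < (n : ℝ) + 1 := by positivity
    refine Integrable.mono' (integrable_const (Real.exp (((n : ℝ) + 1) ^ 2 * s ^ 2)))
      (by fun_prop) (Eventually.of_forall fun x => ?_)
    rw [Real.norm_of_nonneg (Real.exp_pos _).le, Real.exp_le_exp]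
    have : ((n : ℝ) + 1) ^ 2 * s ^ 2 - (-s * x - x ^ 2 / (4 * ((n : ℝ) + 1) ^ 2)) =
        (((n : ℝ) + 1) * s + x / (2 * ((n : ℝ) + 1))) ^ 2 := by
      field_simp
      ring
    nlinarith [sq_nonneg (((n : ℝ) + 1) * s + x / (2 * ((n : ℝ) + 1)))]
  -- Integrability of `exp(-sx)` is not yet known; monotone convergence gives it together with the
  -- value of the integral.
  have hmono := lintegral_tendsto_of_tendsto_of_monotone (μ := μ)
    (f := fun n x => ENNReal.ofReal (f n x)) (F := fun x => ENNReal.ofReal (Real.exp (-s * x)))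
    (fun n => by fun_prop)
    (Eventually.of_forall fun x m n hmn => by
      refine ENNReal.ofReal_le_ofReal (Real.exp_le_exp.mpr ?_)
      have : (m : ℝ) ≤ n := by exact_mod_cast hmn
      gcongr)
    (Eventually.of_forall fun x => by
      refine (ENNReal.continuous_ofReal.tendsto _).comp ((Real.continuous_exp.tendsto _).comp ?_)
      have h1 : Tendsto (fun n : ℕ => 4 * ((n : ℝ) + 1) ^ 2) atTop atTop :=
        (((tendsto_pow_atTop two_ne_zero).comp
          (tendsto_atTop_add_const_right _ _ tendsto_natCast_atTop_atTop))).const_mul_atTop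
            (by norm_num)
      simpa using (tendsto_const_nhds (x := x ^ 2)).div_atTop h1 |>.const_sub (-s * x))
  have hlint : ∫⁻ x, ENNReal.ofReal (Real.exp (-s * x)) ∂μ = ENNReal.ofReal (G s).re := by
    refine tendsto_nhds_unique hmono (((ENNReal.continuous_ofReal.tendsto _).comp hL).congr ?_)
    intro n
    exact ofReal_integral_eq_lintegral_ofReal (hfint n)
      (Eventually.of_forall fun x => (Real.exp_pos _).le)
  have hint : Integrable (fun x => Real.exp (-s * x)) μ := by
    refine ⟨by fun_prop, ?_⟩
    rw [hasFiniteIntegral_iff_ofReal (Eventually.of_forall fun x => (Real.exp_pos _).le), hlint]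
    exact ENNReal.ofReal_lt_top
  refine ⟨hint, ?_⟩
  rw [integral_eq_lintegral_of_nonneg_ae (Eventually.of_forall fun x => (Real.exp_pos _).le)
    (by fun_prop), hlint, ENNReal.toReal_ofReal]
  exact ge_of_tendsto' hL fun n => integral_nonneg fun x => (Real.exp_pos _).le

/-! ### Analyticity, scaling and the Laplace transform of the stable law. -/

/-- The Laplace exponent `∫₀^∞ (e^{-zx} - 1 + zx) dx / x^{α+1}`, for `0 ≤ re z`. -/
noncomputable def laplaceExponent (α : ℝ) (z : ℂ) : ℂ :=
  ∫ x in Set.Ioi (0 : ℝ), (Complex.exp (-(z * x)) - 1 + z * x) / ((x ^ (α + 1) : ℝ) : ℂ)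

/-- The Laplace exponent on the real half-line. -/
noncomputable def realLaplaceExponent (α s : ℝ) : ℝ :=
  ∫ x in Set.Ioi (0 : ℝ), (Real.exp (-(s * x)) - 1 + s * x) / x ^ (α + 1)

theorem pow_div_rpow_add_one {x : ℝ} (hx : 0 < x) (n : ℕ) (α : ℝ) :
    x ^ n / x ^ (α + 1) = x ^ ((n : ℝ) - α - 1) := by
  rw [← Real.rpow_natCast, ← Real.rpow_sub hx]
  congr 1
  ring

theorem integrableOn_Ioc_zero_one_rpow {r : ℝ} (hr : -1 < r) :
    IntegrableOn (fun x : ℝ => x ^ r) (Set.Ioc 0 1) :=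
  (intervalIntegrable_iff_integrableOn_Ioc_of_le zero_le_one).mp
    (intervalIntegral.intervalIntegrable_rpow' hr)

theorem setIntegral_Ioc_zero_one_rpow {r : ℝ} (hr : -1 < r) :
    ∫ x in Set.Ioc (0 : ℝ) 1, x ^ r = 1 / (r + 1) := by
  rw [← intervalIntegral.integral_of_le zero_le_one, integral_rpow (Or.inl hr)]
  simp [Real.zero_rpow (by linarith : r + 1 ≠ 0)]

theorem setIntegral_Ioi_one_rpow {r : ℝ} (hr : r < -1) :
    ∫ x in Set.Ioi (1 : ℝ), x ^ r = -1 / (r + 1) := by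
  rw [integral_Ioi_rpow_of_lt hr one_pos, Real.one_rpow]

/-- This is the dominating function for the integrand and its `z`-derivative: `x²` is integrable
against the Lévy measure near `0` as `α < 2`, and `x` near infinity as `α > 1`. -/
theorem integrableOn_min_div_rpow {α : ℝ} (h1 : 1 < α) (h2 : α < 2) :
    IntegrableOn (fun x : ℝ => min x (x ^ 2) / x ^ (α + 1)) (Set.Ioi 0) := by
  rw [← Set.Ioc_union_Ioi_eq_Ioi zero_le_one]
  refine IntegrableOn.union ?_ ?_
  · refine (integrableOn_Ioc_zero_one_rpow (r := (2 : ℕ) - α - 1) (by push_cast; linarith)).congr_fun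
      (fun x hx => ?_) measurableSet_Ioc
    simp only
    rw [min_eq_right (by nlinarith [hx.1, hx.2]), pow_div_rpow_add_one hx.1]
  · refine (integrableOn_Ioi_rpow_of_lt (a := (1 : ℕ) - α - 1) (by push_cast; linarith)
      one_pos).congr_fun (fun x hx => ?_) measurableSet_Ioi
    have hx : 1 < x := hx
    simp only
    rw [min_eq_left (by nlinarith), ← pow_div_rpow_add_one (by linarith), pow_one]

theorem norm_cexp_neg_sub_one_le {u : ℂ} (hu : 0 ≤ u.re) :
    ‖Complex.exp (-u) - 1‖ ≤ 2 * min 1 ‖u‖ := by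
  have h2 : ‖Complex.exp (-u) - 1‖ ≤ 2 := by
    refine (norm_sub_le _ _).trans ?_
    have : ‖Complex.exp (-u)‖ ≤ 1 := by simpa [Complex.norm_exp] using hu
    rw [norm_one]
    linarith
  rcases le_total ‖u‖ 1 with h | h
  · rw [min_eq_right h]
    simpa using Complex.norm_exp_sub_one_le (x := -u) (by simpa using h)
  · rw [min_eq_left h]
    linarith

theorem norm_cexp_neg_sub_one_add_le {u : ℂ} (hu : 0 ≤ u.re) :
    ‖Complex.exp (-u) - 1 + u‖ ≤ 3 * min ‖u‖ (‖u‖ ^ 2) := by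
  rcases le_total ‖u‖ 1 with h | h
  · rw [min_eq_right (by nlinarith [norm_nonneg u])]
    have := Complex.norm_exp_sub_one_sub_id_le (x := -u) (by simpa using h)
    rw [sub_neg_eq_add, norm_neg] at this
    nlinarith [sq_nonneg ‖u‖]
  · rw [min_eq_left (by nlinarith)]
    refine (norm_add_le _ _).trans ?_
    have := norm_cexp_neg_sub_one_le hu
    rw [min_eq_left h] at this
    linarith

theorem min_mul_le_mul_min {r R x : ℝ} (hr : 0 ≤ r) (hrR : r ≤ R) (hx : 0 ≤ x) :
    min (r * x) ((r * x) ^ 2) ≤ (R + R ^ 2) * min x (x ^ 2) := by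
  rcases min_choice x (x ^ 2) with h | h <;> rw [h]
  · refine (min_le_left _ _).trans ?_
    nlinarith [mul_nonneg (sq_nonneg R) hx, mul_le_mul_of_nonneg_right hrR hx]
  · refine (min_le_right _ _).trans ?_
    rw [mul_pow]
    have : r ^ 2 ≤ R + R ^ 2 := by nlinarith
    gcongr

theorem norm_laplaceExponent_integrand_le (α : ℝ) {z : ℂ} {R x : ℝ} (hz : 0 ≤ z.re)
    (hR : ‖z‖ ≤ R) (hx : 0 < x) :
    ‖(Complex.exp (-(z * x)) - 1 + z * x) / ((x ^ (α + 1) : ℝ) : ℂ)‖ ≤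
      3 * (R + R ^ 2) * (min x (x ^ 2) / x ^ (α + 1)) := by
  have hp : 0 < x ^ (α + 1) := Real.rpow_pos_of_pos hx _
  rw [norm_div, Complex.norm_real, Real.norm_of_nonneg hp.le, mul_div_assoc']
  gcongr
  have h1 := norm_cexp_neg_sub_one_add_le (u := z * x) (by simpa using mul_nonneg hz hx.le)
  rw [norm_mul, Complex.norm_real, Real.norm_of_nonneg hx.le] at h1
  have h2 := min_mul_le_mul_min (norm_nonneg z) hR hx.le
  linarith

theorem aestronglyMeasurable_laplaceExponent_integrand (α : ℝ) (z : ℂ) :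
    AEStronglyMeasurable (fun x : ℝ => (Complex.exp (-(z * x)) - 1 + z * x) /
      ((x ^ (α + 1) : ℝ) : ℂ)) (volume.restrict (Set.Ioi 0)) := by
  refine Measurable.aestronglyMeasurable ?_
  fun_prop

theorem integrableOn_laplaceExponent_integrand {α : ℝ} (h1 : 1 < α) (h2 : α < 2) {z : ℂ}
    (hz : 0 ≤ z.re) :
    IntegrableOn (fun x : ℝ => (Complex.exp (-(z * x)) - 1 + z * x) /
      ((x ^ (α + 1) : ℝ) : ℂ)) (Set.Ioi 0) :=
  Integrable.mono' ((integrableOn_min_div_rpow h1 h2).const_mul (3 * (‖z‖ + ‖z‖ ^ 2)))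
    (aestronglyMeasurable_laplaceExponent_integrand α z)
    ((ae_restrict_iff' measurableSet_Ioi).mpr (Filter.Eventually.of_forall fun _ hx =>
      norm_laplaceExponent_integrand_le α hz le_rfl hx))

theorem continuousOn_laplaceExponent {α : ℝ} (h1 : 1 < α) (h2 : α < 2) :
    ContinuousOn (laplaceExponent α) {z | 0 ≤ z.re} := by
  intro z₀ hz₀
  have hU : {z : ℂ | 0 ≤ z.re} ∩ Metric.ball 0 (‖z₀‖ + 1) ∈ nhdsWithin z₀ {z : ℂ | 0 ≤ z.re} :=
    Filter.inter_mem self_mem_nhdsWithin (mem_nhdsWithin_of_mem_nhds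
      (Metric.isOpen_ball.mem_nhds (by simp)))
  have : ContinuousOn (laplaceExponent α) ({z : ℂ | 0 ≤ z.re} ∩ Metric.ball 0 (‖z₀‖ + 1)) := by
    refine continuousOn_of_dominated
      (fun z _ => aestronglyMeasurable_laplaceExponent_integrand α z) (fun z hz => ?_)
      ((integrableOn_min_div_rpow h1 h2).const_mul
        (3 * ((‖z₀‖ + 1) + (‖z₀‖ + 1) ^ 2))) (Filter.Eventually.of_forall fun x => ?_)
    · refine (ae_restrict_iff' measurableSet_Ioi).mpr (Filter.Eventually.of_forall fun x hx => ?_)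
      exact norm_laplaceExponent_integrand_le α hz.1 (by simpa using (mem_ball_zero_iff.mp hz.2).le)
        hx
    · fun_prop
  exact (this z₀ ⟨hz₀, by simp⟩).mono_of_mem_nhdsWithin hU

theorem differentiableOn_laplaceExponent {α : ℝ} (h1 : 1 < α) (h2 : α < 2) :
    DifferentiableOn ℂ (laplaceExponent α) {z | 0 < z.re} := by
  intro z₀ hz₀
  have hopen : IsOpen ({z : ℂ | 0 < z.re} ∩ Metric.ball 0 (‖z₀‖ + 1)) :=
    (isOpen_lt continuous_const Complex.continuous_re).inter Metric.isOpen_ball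
  have hU := hopen.mem_nhds (⟨hz₀, by simp⟩ : z₀ ∈ {z : ℂ | 0 < z.re} ∩ Metric.ball 0 (‖z₀‖ + 1))
  have := hasDerivAt_integral_of_dominated_loc_of_deriv_le
    (μ := volume.restrict (Set.Ioi (0 : ℝ)))
    (F := fun (z : ℂ) (x : ℝ) => (Complex.exp (-(z * x)) - 1 + z * x) / ((x ^ (α + 1) : ℝ) : ℂ))
    (F' := fun (z : ℂ) (x : ℝ) => (Complex.exp (-(z * x)) * (-x) + x) / ((x ^ (α + 1) : ℝ) : ℂ))
    (bound := fun x => 2 * (1 + (‖z₀‖ + 1)) * (min x (x ^ 2) / x ^ (α + 1))) hU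
    (Filter.Eventually.of_forall fun z => aestronglyMeasurable_laplaceExponent_integrand α z)
    (integrableOn_laplaceExponent_integrand h1 h2 (le_of_lt hz₀))
    (Measurable.aestronglyMeasurable (by fun_prop))
    ?_ ((integrableOn_min_div_rpow h1 h2).const_mul _)
    (Filter.Eventually.of_forall fun x z _ => ?_)
  · exact this.2.differentiableAt.differentiableWithinAt
  · refine (ae_restrict_iff' measurableSet_Ioi).mpr (Filter.Eventually.of_forall fun x hx z hz => ?_)
    have hx : 0 < x := hx
    have hp : 0 < x ^ (α + 1) := Real.rpow_pos_of_pos hx _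
    have hzR : ‖z‖ ≤ ‖z₀‖ + 1 := by simpa using (mem_ball_zero_iff.mp hz.2).le
    rw [norm_div, Complex.norm_real, Real.norm_of_nonneg hp.le, mul_div_assoc']
    gcongr
    have hu := norm_cexp_neg_sub_one_le (u := z * x)
      (by simpa using mul_nonneg (le_of_lt hz.1) hx.le)
    rw [norm_mul, Complex.norm_real, Real.norm_of_nonneg hx.le] at hu
    rw [show Complex.exp (-(z * x)) * (-x) + x = -(x * (Complex.exp (-(z * x)) - 1)) by ring,
      norm_neg, norm_mul, Complex.norm_real, Real.norm_of_nonneg hx.le]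
    have hm : x * min 1 (‖z‖ * x) ≤ (1 + (‖z₀‖ + 1)) * min x (x ^ 2) := by
      rcases min_choice x (x ^ 2) with h | h <;> rw [h]
      · have := min_le_left 1 (‖z‖ * x)
        nlinarith [norm_nonneg z₀, mul_nonneg hx.le (norm_nonneg z₀)]
      · have := min_le_right 1 (‖z‖ * x)
        nlinarith [mul_le_mul_of_nonneg_left this hx.le,
          mul_le_mul_of_nonneg_right hzR (sq_nonneg x)]
    nlinarith [mul_le_mul_of_nonneg_left hu hx.le]
  · have hlin : HasDerivAt (fun z : ℂ => z * (x : ℂ)) x z := by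
      simpa using (hasDerivAt_id z).mul_const (x : ℂ)
    exact (((hlin.neg.cexp).sub_const 1).add hlin).div_const _

theorem laplaceExponent_ofReal (α s : ℝ) :
    laplaceExponent α s = realLaplaceExponent α s := by
  rw [laplaceExponent, realLaplaceExponent, ← integral_complex_ofReal]
  congr 1
  funext x
  push_cast
  rfl

theorem stableExponent_eq_laplaceExponent (α t : ℝ) :
    stableExponent α t = laplaceExponent α (-(t * Complex.I)) := by
  rw [stableExponent, laplaceExponent]
  congr 1
  funext x
  rw [show -(-(t * Complex.I) * x) = Complex.I * t * x by ring]
  ring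

theorem integrableOn_realLaplaceExponent_integrand {α : ℝ} (h1 : 1 < α) (h2 : α < 2) {s : ℝ}
    (hs : 0 ≤ s) :
    IntegrableOn (fun x : ℝ => (Real.exp (-(s * x)) - 1 + s * x) / x ^ (α + 1)) (Set.Ioi 0) := by
  have := (integrableOn_laplaceExponent_integrand h1 h2 (z := (s : ℂ)) (by simpa using hs)).re
  refine this.congr (Filter.Eventually.of_forall fun x => ?_)
  simp only [RCLike.re_to_complex]
  rw [← Complex.ofReal_re ((Real.exp (-(s * x)) - 1 + s * x) / x ^ (α + 1))]
  push_cast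
  rfl

/-- Since `|e^{-zx}| = e^{-x re z}`, the bound holds pointwise under the integral. It makes
`exp(laplaceExponent α z)` bounded on strips. -/
theorem re_laplaceExponent_le {α : ℝ} (h1 : 1 < α) (h2 : α < 2) {z : ℂ} (hz : 0 ≤ z.re) :
    (laplaceExponent α z).re ≤ realLaplaceExponent α z.re := by
  have hint := integrableOn_laplaceExponent_integrand h1 h2 hz
  have hre := integral_re hint
  simp only [RCLike.re_to_complex] at hre
  rw [laplaceExponent, ← hre, realLaplaceExponent]
  refine setIntegral_mono_on hint.re (integrableOn_realLaplaceExponent_integrand h1 h2 hz)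
    measurableSet_Ioi fun x hx => ?_
  have hp : 0 < x ^ (α + 1) := Real.rpow_pos_of_pos hx _
  rw [Complex.div_ofReal_re]
  gcongr
  have : (Complex.exp (-(z * x))).re ≤ Real.exp (-(z.re * x)) := by
    refine (Complex.re_le_norm _).trans ?_
    simp [Complex.norm_exp]
  simpa using this

theorem realLaplaceExponent_eq_mul_rpow (α : ℝ) {s : ℝ} (hs : 0 < s) :
    realLaplaceExponent α s = realLaplaceExponent α 1 * s ^ α := by
  have h := integral_comp_mul_left_Ioi
    (fun x : ℝ => (Real.exp (-(1 * x)) - 1 + 1 * x) / x ^ (α + 1)) 0 hs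
  rw [mul_zero, smul_eq_mul] at h
  have hpow : s ^ (α + 1) = s ^ α * s := by rw [Real.rpow_add hs, Real.rpow_one]
  have hsα : 0 < s ^ α := Real.rpow_pos_of_pos hs _
  have h2 : realLaplaceExponent α s = s ^ (α + 1) * ∫ x in Set.Ioi (0 : ℝ),
      (Real.exp (-(1 * (s * x))) - 1 + 1 * (s * x)) / (s * x) ^ (α + 1) := by
    rw [realLaplaceExponent, ← integral_const_mul]
    refine setIntegral_congr_fun measurableSet_Ioi fun x hx => ?_
    have hx : 0 < x := hx
    have hxp : 0 < x ^ (α + 1) := Real.rpow_pos_of_pos hx _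
    have hsp : 0 < s ^ (α + 1) := Real.rpow_pos_of_pos hs _
    simp only [one_mul]
    rw [Real.mul_rpow hs.le hx.le]
    field_simp
  rw [h2, h, hpow, ← realLaplaceExponent]
  field_simp

/-- The Laplace transform of the totally asymmetric stable law. -/
theorem integrable_exp_and_integral_exp_of_charFun_stable {α : ℝ} (h1 : 1 < α) (h2 : α < 2)
    {μ : Measure ℝ} [IsProbabilityMeasure μ]
    (hμ : ∀ t : ℝ, charFun μ t = Complex.exp (stableExponent α t)) {s : ℝ} (hs : 0 < s) :
    Integrable (fun x => Real.exp (-s * x)) μ ∧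
      ∫ x, Real.exp (-s * x) ∂μ = Real.exp (realLaplaceExponent α s) := by
  have hnonneg : 0 ≤ realLaplaceExponent α 1 := by
    refine setIntegral_nonneg measurableSet_Ioi fun x hx => ?_
    have := Real.add_one_le_exp (-(1 * x))
    exact div_nonneg (by linarith) (Real.rpow_nonneg (le_of_lt hx) _)
  have h := integrable_exp_and_integral_exp_of_charFun_eq (μ := μ)
    (G := fun z => Complex.exp (laplaceExponent α z))
    (B := Real.exp (realLaplaceExponent α s)) hs.le
    ((continuousOn_laplaceExponent h1 h2).mono fun z hz => hz.1).cexp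
    ((differentiableOn_laplaceExponent h1 h2).mono fun z hz => hz.1).cexp
    (fun z hz0 hzs => ?_) (fun t => by rw [hμ, stableExponent_eq_laplaceExponent])
  · rw [laplaceExponent_ofReal, ← Complex.ofReal_exp, Complex.ofReal_re] at h
    exact h
  · rw [Complex.norm_exp, Real.exp_le_exp]
    refine (re_laplaceExponent_le h1 h2 hz0).trans ?_
    -- Monotonicity in `re z` comes from the scaling identity, which covers only positive arguments.
    rcases hz0.eq_or_lt with h0 | h0
    · rw [← h0, realLaplaceExponent_eq_mul_rpow α hs]
      have : realLaplaceExponent α 0 = 0 := by simp [realLaplaceExponent]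
      rw [this]
      positivity
    · rw [realLaplaceExponent_eq_mul_rpow α hs, realLaplaceExponent_eq_mul_rpow α h0]
      gcongr

/-! ### Explicit bounds on the real Laplace exponent. -/

/-- From `e^u ≥ 1 + u + u²/2` and `(1 + u + u²/2)(1 - u + u²/2) = 1 + u⁴/4 ≥ 1`. -/
theorem exp_neg_le_one_sub_add_sq {u : ℝ} (hu : 0 ≤ u) : Real.exp (-u) ≤ 1 - u + u ^ 2 / 2 := by
  have h := Real.quadratic_le_exp_of_nonneg hu
  rw [Real.exp_neg, inv_le_comm₀ (Real.exp_pos u) (by nlinarith [sq_nonneg (u - 1)])]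
  refine le_trans ?_ h
  rw [inv_le_iff_one_le_mul₀ (by nlinarith [sq_nonneg (u - 1)])]
  nlinarith [sq_nonneg (u ^ 2)]

theorem one_sub_add_sq_sub_cube_le_exp_neg {u : ℝ} (hu : 0 ≤ u) :
    1 - u + u ^ 2 / 2 - u ^ 3 / 6 ≤ Real.exp (-u) := by
  have hder : ∀ x : ℝ, HasDerivAt (fun x : ℝ => Real.exp (-x) - (1 - x + x ^ 2 / 2 - x ^ 3 / 6))
      (Real.exp (-x) * (-1) - (-1 + 2 * x / 2 - 3 * x ^ 2 / 6)) x := by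
    intro x
    have e := (hasDerivAt_id x).neg.exp
    have p2 := (hasDerivAt_pow 2 x).div_const 2
    have p3 := (hasDerivAt_pow 3 x).div_const 6
    have p1 := (hasDerivAt_id x).const_sub 1
    exact (e.sub ((p1.add p2).sub p3)).congr_deriv (by simp)
  have hmono : MonotoneOn (fun x : ℝ => Real.exp (-x) - (1 - x + x ^ 2 / 2 - x ^ 3 / 6))
      (Set.Ici 0) := by
    refine monotoneOn_of_deriv_nonneg (convex_Ici 0) (by fun_prop)
      (fun x _ => (hder x).differentiableAt.differentiableWithinAt) fun x hx => ?_
    rw [interior_Ici] at hx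
    rw [(hder x).deriv]
    have := exp_neg_le_one_sub_add_sq (le_of_lt hx)
    linarith
  have := hmono (Set.mem_Ici.mpr le_rfl) (Set.mem_Ici.mpr hu) hu
  simp only [neg_zero, Real.exp_zero] at this
  linarith

/-- Upper bound for an integral against `x^{-α-1}` on the half-line, from a quadratic bound on
`(0, 1]` and an affine bound on `(1, ∞)`. -/
theorem setIntegral_div_rpow_le {α a b c : ℝ} (h1 : 1 < α) (h2 : α < 2) {g : ℝ → ℝ}
    (hg : IntegrableOn (fun x => g x / x ^ (α + 1)) (Set.Ioi 0))
    (hsmall : ∀ x ∈ Set.Ioc (0 : ℝ) 1, g x ≤ a * x ^ 2)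
    (hlarge : ∀ x ∈ Set.Ioi (1 : ℝ), g x ≤ b * x + c) :
    ∫ x in Set.Ioi (0 : ℝ), g x / x ^ (α + 1) ≤ a / (2 - α) + b / (α - 1) + c / α := by
  rw [← Set.Ioc_union_Ioi_eq_Ioi zero_le_one] at hg ⊢
  have hgs := hg.mono_set Set.subset_union_left
  have hgl := hg.mono_set Set.subset_union_right
  rw [setIntegral_union (Set.Ioc_disjoint_Ioi le_rfl) measurableSet_Ioi hgs hgl]
  have hr2 : (-1 : ℝ) < (2 : ℕ) - α - 1 := by push_cast; linarith
  have hr1 : ((1 : ℕ) : ℝ) - α - 1 < -1 := by push_cast; linarith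
  have hr0 : ((0 : ℕ) : ℝ) - α - 1 < -1 := by push_cast; linarith
  have hs : ∫ x in Set.Ioc (0 : ℝ) 1, g x / x ^ (α + 1) ≤ a / (2 - α) := by
    calc _ ≤ ∫ x in Set.Ioc (0 : ℝ) 1, a * x ^ ((2 : ℕ) - α - 1) := by
          refine setIntegral_mono_on hgs ((integrableOn_Ioc_zero_one_rpow hr2).const_mul a)
            measurableSet_Ioc fun x hx => ?_
          have hp : 0 < x ^ (α + 1) := Real.rpow_pos_of_pos hx.1 _
          rw [← pow_div_rpow_add_one hx.1, mul_div_assoc']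
          gcongr
          exact hsmall x hx
      _ = _ := by
          rw [integral_const_mul, setIntegral_Ioc_zero_one_rpow hr2]
          push_cast
          ring_nf
  have hl : ∫ x in Set.Ioi (1 : ℝ), g x / x ^ (α + 1) ≤ b / (α - 1) + c / α := by
    have i1 := (integrableOn_Ioi_rpow_of_lt hr1 one_pos).const_mul b
    have i0 := (integrableOn_Ioi_rpow_of_lt hr0 one_pos).const_mul c
    calc _ ≤ ∫ x in Set.Ioi (1 : ℝ), (b * x ^ ((1 : ℕ) - α - 1) + c * x ^ ((0 : ℕ) - α - 1)) := by
          refine setIntegral_mono_on hgl (i1.add i0) measurableSet_Ioi fun x hx => ?_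
          have hx0 : 0 < x := lt_trans one_pos hx
          have hp : 0 < x ^ (α + 1) := Real.rpow_pos_of_pos hx0 _
          rw [← pow_div_rpow_add_one hx0, ← pow_div_rpow_add_one hx0, mul_div_assoc',
            mul_div_assoc', ← add_div]
          gcongr
          simpa using hlarge x hx
      _ = _ := by
          rw [integral_add i1 i0, integral_const_mul, integral_const_mul,
            setIntegral_Ioi_one_rpow hr1, setIntegral_Ioi_one_rpow hr0]
          have e1 : ((1 : ℕ) : ℝ) - α - 1 + 1 = -(α - 1) := by push_cast; ring
          have e0 : ((0 : ℕ) : ℝ) - α - 1 + 1 = -α := by push_cast; ring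
          rw [e1, e0, neg_div_neg_eq, neg_div_neg_eq]
          ring
  linarith

/-- Lower bound for an integral against `x^{-α-1}` on the half-line, from a cubic bound on
`(0, 1]` and an affine bound on `(1, ∞)`. -/
theorem le_setIntegral_div_rpow {α a d b c : ℝ} (h1 : 1 < α) (h2 : α < 2) {g : ℝ → ℝ}
    (hg : IntegrableOn (fun x => g x / x ^ (α + 1)) (Set.Ioi 0))
    (hsmall : ∀ x ∈ Set.Ioc (0 : ℝ) 1, a * x ^ 2 + d * x ^ 3 ≤ g x)
    (hlarge : ∀ x ∈ Set.Ioi (1 : ℝ), b * x + c ≤ g x) :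
    a / (2 - α) + d / (3 - α) + b / (α - 1) + c / α ≤
      ∫ x in Set.Ioi (0 : ℝ), g x / x ^ (α + 1) := by
  rw [← Set.Ioc_union_Ioi_eq_Ioi zero_le_one] at hg ⊢
  have hgs := hg.mono_set Set.subset_union_left
  have hgl := hg.mono_set Set.subset_union_right
  rw [setIntegral_union (Set.Ioc_disjoint_Ioi le_rfl) measurableSet_Ioi hgs hgl]
  have hr3 : (-1 : ℝ) < (3 : ℕ) - α - 1 := by push_cast; linarith
  have hr2 : (-1 : ℝ) < (2 : ℕ) - α - 1 := by push_cast; linarith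
  have hr1 : ((1 : ℕ) : ℝ) - α - 1 < -1 := by push_cast; linarith
  have hr0 : ((0 : ℕ) : ℝ) - α - 1 < -1 := by push_cast; linarith
  have hs : a / (2 - α) + d / (3 - α) ≤ ∫ x in Set.Ioc (0 : ℝ) 1, g x / x ^ (α + 1) := by
    have i2 := (integrableOn_Ioc_zero_one_rpow hr2).const_mul a
    have i3 := (integrableOn_Ioc_zero_one_rpow hr3).const_mul d
    calc _ = ∫ x in Set.Ioc (0 : ℝ) 1, (a * x ^ ((2 : ℕ) - α - 1) + d * x ^ ((3 : ℕ) - α - 1)) := by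
          rw [integral_add i2 i3, integral_const_mul, integral_const_mul,
            setIntegral_Ioc_zero_one_rpow hr2, setIntegral_Ioc_zero_one_rpow hr3]
          push_cast
          ring_nf
      _ ≤ _ := by
          refine setIntegral_mono_on (i2.add i3) hgs measurableSet_Ioc fun x hx => ?_
          have hp : 0 < x ^ (α + 1) := Real.rpow_pos_of_pos hx.1 _
          rw [← pow_div_rpow_add_one hx.1, ← pow_div_rpow_add_one hx.1, mul_div_assoc',
            mul_div_assoc', ← add_div]
          gcongr
          exact hsmall x hx
  have hl : b / (α - 1) + c / α ≤ ∫ x in Set.Ioi (1 : ℝ), g x / x ^ (α + 1) := by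
    have i1 := (integrableOn_Ioi_rpow_of_lt hr1 one_pos).const_mul b
    have i0 := (integrableOn_Ioi_rpow_of_lt hr0 one_pos).const_mul c
    calc _ = ∫ x in Set.Ioi (1 : ℝ), (b * x ^ ((1 : ℕ) - α - 1) + c * x ^ ((0 : ℕ) - α - 1)) := by
          rw [integral_add i1 i0, integral_const_mul, integral_const_mul,
            setIntegral_Ioi_one_rpow hr1, setIntegral_Ioi_one_rpow hr0]
          have e1 : ((1 : ℕ) : ℝ) - α - 1 + 1 = -(α - 1) := by push_cast; ring
          have e0 : ((0 : ℕ) : ℝ) - α - 1 + 1 = -α := by push_cast; ring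
          rw [e1, e0, neg_div_neg_eq, neg_div_neg_eq]
          ring
      _ ≤ _ := by
          refine setIntegral_mono_on (i1.add i0) hgl measurableSet_Ioi fun x hx => ?_
          have hx0 : 0 < x := lt_trans one_pos hx
          have hp : 0 < x ^ (α + 1) := Real.rpow_pos_of_pos hx0 _
          rw [← pow_div_rpow_add_one hx0, ← pow_div_rpow_add_one hx0, mul_div_assoc',
            mul_div_assoc', ← add_div]
          gcongr
          simpa using hlarge x hx
  linarith

theorem realLaplaceExponent_le {α s : ℝ} (h1 : 1 < α) (h2 : α < 2) (hs : 0 ≤ s) :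
    realLaplaceExponent α s ≤
      s ^ 2 / 2 / (2 - α) + s / (α - 1) + (Real.exp (-s) - 1) / α := by
  refine setIntegral_div_rpow_le h1 h2 (integrableOn_realLaplaceExponent_integrand h1 h2 hs)
    (fun x hx => ?_) (fun x hx => ?_)
  · have := exp_neg_le_one_sub_add_sq (mul_nonneg hs hx.1.le)
    linarith
  · have hx : 1 < x := hx
    have : Real.exp (-(s * x)) ≤ Real.exp (-s) := Real.exp_le_exp.mpr (by nlinarith)
    linarith

theorem le_realLaplaceExponent {α s : ℝ} (h1 : 1 < α) (h2 : α < 2) (hs : 0 ≤ s) :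
    s ^ 2 / 2 / (2 - α) + -(s ^ 3 / 6) / (3 - α) + s / (α - 1) + -1 / α ≤
      realLaplaceExponent α s := by
  refine le_setIntegral_div_rpow h1 h2 (integrableOn_realLaplaceExponent_integrand h1 h2 hs)
    (fun x hx => ?_) (fun x hx => ?_)
  · have := one_sub_add_sq_sub_cube_le_exp_neg (mul_nonneg hs hx.1.le)
    linarith
  · have := Real.exp_pos (-(s * x))
    linarith

/-- This difference is the cost in Paley–Zygmund. The linear terms cancel and the integrand
numerator is `(1 - e^{-sx})²`, at most `s²x²` near `0` and at most `1` beyond. -/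
theorem realLaplaceExponent_two_mul_sub_le {α s : ℝ} (h1 : 1 < α) (h2 : α < 2) (hs : 0 ≤ s) :
    realLaplaceExponent α (2 * s) - 2 * realLaplaceExponent α s ≤ s ^ 2 / (2 - α) + 1 / α := by
  have i1 := integrableOn_realLaplaceExponent_integrand h1 h2 hs
  have i2 := integrableOn_realLaplaceExponent_integrand h1 h2 (mul_nonneg zero_le_two hs)
  have hpt : (fun x : ℝ => (Real.exp (-(2 * s * x)) - 1 + 2 * s * x) / x ^ (α + 1) -
      2 * ((Real.exp (-(s * x)) - 1 + s * x) / x ^ (α + 1))) =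
      fun x : ℝ => (1 - Real.exp (-(s * x))) ^ 2 / x ^ (α + 1) := by
    funext x
    rw [show -(2 * s * x) = -(s * x) + -(s * x) by ring, Real.exp_add]
    ring
  have hi := i2.sub (i1.const_mul 2)
  have heq : realLaplaceExponent α (2 * s) - 2 * realLaplaceExponent α s =
      ∫ x in Set.Ioi (0 : ℝ), (1 - Real.exp (-(s * x))) ^ 2 / x ^ (α + 1) := by
    rw [realLaplaceExponent, realLaplaceExponent, ← integral_const_mul,
      ← integral_sub i2 (i1.const_mul 2), hpt]
  rw [heq]
  have := setIntegral_div_rpow_le (a := s ^ 2) (b := 0) (c := 1) h1 h2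
    (g := fun x => (1 - Real.exp (-(s * x))) ^ 2) (by rw [← hpt]; exact hi)
    (fun x hx => ?_) (fun x hx => ?_)
  · simpa using this
  · have h0 : 0 ≤ s * x := mul_nonneg hs hx.1.le
    have l := Real.add_one_le_exp (-(s * x))
    have u : Real.exp (-(s * x)) ≤ 1 := Real.exp_le_one_iff.mpr (by linarith)
    nlinarith
  · have h0 : 0 ≤ s * x := mul_nonneg hs (lt_trans one_pos hx).le
    have l := Real.exp_pos (-(s * x))
    have u : Real.exp (-(s * x)) ≤ 1 := Real.exp_le_one_iff.mpr (by linarith)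
    nlinarith

theorem realLaplaceExponent_one_le {α : ℝ} (h1 : 1 < α) (h2 : α < 2) :
    realLaplaceExponent α 1 ≤ (1 / (2 - α) + 1 / (α - 1)) / α := by
  refine (realLaplaceExponent_le h1 h2 zero_le_one).trans ?_
  have he : Real.exp (-1) ≤ 1 / 2 := by
    rw [Real.exp_neg, inv_le_comm₀ (Real.exp_pos 1) (by norm_num)]
    have := Real.add_one_le_exp (1 : ℝ)
    linarith
  have ha : 0 < α - 1 := by linarith
  have hd : 0 < 2 - α := by linarith
  have h0 : 0 < α := by linarith
  calc _ ≤ (1 : ℝ) ^ 2 / 2 / (2 - α) + 1 / (α - 1) + (1 / 2 - 1) / α := by gcongr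
    -- The crude `e^{-1} ≤ 1/2` is just what makes this an identity.
    _ = (1 / (2 - α) + 1 / (α - 1)) / α := by
      field_simp
      ring

theorem le_realLaplaceExponent_one {α : ℝ} (h1 : 1 < α) (h2 : α < 2) :
    4 / 5 * ((1 / (2 - α) + 1 / (α - 1)) / α) ≤ realLaplaceExponent α 1 := by
  refine le_trans ?_ (le_realLaplaceExponent h1 h2 zero_le_one)
  have ha : 0 < α - 1 := by linarith
  have hd : 0 < 2 - α := by linarith
  have h3 : 0 < 3 - α := by linarith
  have h0 : 0 < α := by linarith
  have key : ((1 : ℝ) ^ 2 / 2 / (2 - α) + -((1 : ℝ) ^ 3 / 6) / (3 - α) + 1 / (α - 1) + -1 / α) -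
      4 / 5 * ((1 / (2 - α) + 1 / (α - 1)) / α) =
      ((3 - α) * (6 - 15 * ((α - 1) * (2 - α))) - 5 * (α * (α - 1) * (2 - α))) /
        (30 * (α * (α - 1) * (2 - α) * (3 - α))) := by
    field_simp
    ring
  rw [← sub_nonneg, key]
  refine div_nonneg ?_ (by positivity)
  nlinarith [sq_nonneg (2 * α - 3), mul_pos ha hd, mul_pos (mul_pos ha hd) h0]

/-! ### Tail bounds from exponential moments. -/

/-- Chernoff bound for the left tail. -/
theorem measureReal_Iic_neg_le_exp {μ : Measure ℝ} [IsProbabilityMeasure μ] {s w l : ℝ}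
    (hs : 0 < s) (hi : Integrable (fun x => Real.exp (-s * x)) μ)
    (hl : ∫ x, Real.exp (-s * x) ∂μ = Real.exp l) :
    μ.real (Set.Iic (-w)) ≤ Real.exp (l - s * w) := by
  have hind : Integrable ((Set.Iic (-w)).indicator (fun _ : ℝ => Real.exp (s * w))) μ :=
    (integrable_const _).indicator measurableSet_Iic
  have h := integral_mono hind hi fun x => by
    rw [Set.indicator_apply]
    split_ifs with hx
    · have hx : x ≤ -w := hx
      exact Real.exp_le_exp.mpr (by nlinarith)
    · exact (Real.exp_pos _).le
  rw [integral_indicator_const _ measurableSet_Iic, hl, smul_eq_mul] at h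
  rw [Real.exp_sub, le_div_iff₀ (Real.exp_pos _)]
  exact h

/-- Paley–Zygmund bound for the left tail. -/
theorem le_measureReal_Iic_neg {μ : Measure ℝ} [IsProbabilityMeasure μ] {s w c l₁ l₂ : ℝ}
    (hs : 0 < s) (hc : 0 < c) (hi₁ : Integrable (fun x => Real.exp (-s * x)) μ)
    (hl₁ : ∫ x, Real.exp (-s * x) ∂μ = Real.exp l₁)
    (hi₂ : Integrable (fun x => Real.exp (-(2 * s) * x)) μ)
    (hl₂ : ∫ x, Real.exp (-(2 * s) * x) ∂μ = Real.exp l₂) (hw : s * w + c ≤ l₁) :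
    (1 - Real.exp (-c)) ^ 2 * Real.exp (-(l₂ - 2 * l₁)) ≤ μ.real (Set.Iic (-w)) := by
  set p := μ.real (Set.Iic (-w)) with hp
  have hc1 : Real.exp (-c) < 1 := by simpa using hc
  have hm : Real.exp l₁ * (1 - Real.exp (-c)) ≤ Real.exp l₁ - Real.exp (s * w) := by
    have : Real.exp (s * w) ≤ Real.exp l₁ * Real.exp (-c) := by
      rw [← Real.exp_add]
      exact Real.exp_le_exp.mpr (by linarith)
    linarith
  have hm0 : 0 < Real.exp l₁ * (1 - Real.exp (-c)) :=
    mul_pos (Real.exp_pos _) (by linarith)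
  set m := Real.exp l₁ - Real.exp (s * w) with hmdef
  have hmpos : 0 < m := hm0.trans_le hm
  -- Cauchy–Schwarz in linearized form: `u ≤ u²/(2θ) + θ/2` on the event, `u ≤ e^{sw}` off it, where
  -- `u = e^{-sx}`.
  have hθ : ∀ θ : ℝ, 0 < θ → m ≤ Real.exp l₂ / (2 * θ) + θ / 2 * p := by
    intro θ hθ
    have hind : Integrable ((Set.Iic (-w)).indicator (fun _ : ℝ => θ / 2)) μ :=
      (integrable_const _).indicator measurableSet_Iic
    have h := integral_mono hi₁ (((integrable_const (Real.exp (s * w))).add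
      (hi₂.div_const (2 * θ))).add hind) fun x => by
        simp only [Pi.add_apply]
        have e2 : Real.exp (-(2 * s) * x) = Real.exp (-s * x) ^ 2 := by
          rw [sq, ← Real.exp_add]
          ring_nf
        rw [e2, Set.indicator_apply]
        split_ifs with hx
        · have : Real.exp (-s * x) ≤ Real.exp (-s * x) ^ 2 / (2 * θ) + θ / 2 := by
            have : Real.exp (-s * x) ^ 2 / (2 * θ) + θ / 2 - Real.exp (-s * x) =
                (Real.exp (-s * x) - θ) ^ 2 / (2 * θ) := by
              field_simp
              ring
            have : 0 ≤ (Real.exp (-s * x) - θ) ^ 2 / (2 * θ) := by positivity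
            linarith
          linarith [Real.exp_pos (s * w)]
        · have hx : -w < x := not_le.mp hx
          have : Real.exp (-s * x) ≤ Real.exp (s * w) := Real.exp_le_exp.mpr (by nlinarith)
          have : 0 ≤ Real.exp (-s * x) ^ 2 / (2 * θ) := by positivity
          linarith
    rw [integral_add' ((integrable_const _).add (hi₂.div_const _)) hind,
      integral_add' (integrable_const _) (hi₂.div_const _), integral_div, hl₁, hl₂,
      integral_indicator_const _ measurableSet_Iic, integral_const] at h
    simp only [probReal_univ, smul_eq_mul, one_mul] at h
    rw [hmdef, hp]
    linarith
  have hsq : m ^ 2 ≤ Real.exp l₂ * p := by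
    -- This `θ` recovers the full Cauchy–Schwarz bound without dividing by `p`.
    have h := hθ (Real.exp l₂ / m) (div_pos (Real.exp_pos _) hmpos)
    have e : Real.exp l₂ / (2 * (Real.exp l₂ / m)) = m / 2 := by
      field_simp
    rw [e] at h
    have h' : m / 2 ≤ Real.exp l₂ * p / (2 * m) := by
      have : Real.exp l₂ / m / 2 * p = Real.exp l₂ * p / (2 * m) := by
        field_simp
      linarith
    rw [le_div_iff₀ (by positivity)] at h'
    linarith
  have hfin : (Real.exp l₁ * (1 - Real.exp (-c))) ^ 2 ≤ Real.exp l₂ * p :=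
    (pow_le_pow_left₀ hm0.le hm 2).trans hsq
  have e : Real.exp (-(l₂ - 2 * l₁)) = Real.exp l₁ ^ 2 / Real.exp l₂ := by
    rw [sq, ← Real.exp_add, ← Real.exp_sub]
    ring_nf
  rw [e, mul_div_assoc', div_le_iff₀ (Real.exp_pos _)]
  linarith

theorem self_le_two_rpow {p : ℝ} (hp : 1 ≤ p) : p ≤ 2 ^ p := by
  have := one_add_mul_self_le_rpow_one_add (by norm_num : (-1 : ℝ) ≤ 1) hp
  norm_num at this
  linarith

/-! ### Moderate deviations: the choice `s = (2-α)y`. -/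

/-- Moderate deviations, upper bound. -/
theorem stable_left_tail_le_gaussian {α : ℝ} (h1 : 1 < α) (h2 : α < 2)
    {μ : Measure ℝ} [IsProbabilityMeasure μ]
    (hμ : ∀ t : ℝ, charFun μ t = Complex.exp (stableExponent α t)) {y : ℝ} (hy : 0 < y) :
    μ.real (Set.Iic (-y - 1 / (α - 1))) ≤ Real.exp (-(1 / 2) * (2 - α) * y ^ 2) := by
  have hd : 0 < 2 - α := by linarith
  have ha : 0 < α - 1 := by linarith
  -- This `s` minimizes `s²/(2(2-α)) - sy`.
  have hs : 0 < (2 - α) * y := mul_pos hd hy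
  obtain ⟨hi, hl⟩ := integrable_exp_and_integral_exp_of_charFun_stable h1 h2 hμ hs
  have h := measureReal_Iic_neg_le_exp (w := y + 1 / (α - 1)) hs hi hl
  rw [show -(y + 1 / (α - 1)) = -y - 1 / (α - 1) by ring] at h
  refine h.trans (Real.exp_le_exp.mpr ?_)
  have hψ := realLaplaceExponent_le h1 h2 hs.le
  have hneg : (Real.exp (-((2 - α) * y)) - 1) / α ≤ 0 :=
    div_nonpos_of_nonpos_of_nonneg
      (by linarith [Real.exp_le_one_iff.mpr (neg_nonpos.mpr hs.le)]) (by linarith)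
  have e1 : ((2 - α) * y) ^ 2 / 2 / (2 - α) = (2 - α) * y ^ 2 / 2 := by
    field_simp
  have e2 : (2 - α) * y * (y + 1 / (α - 1)) = (2 - α) * y ^ 2 + (2 - α) * y / (α - 1) := by
    ring
  rw [e1] at hψ
  rw [e2]
  linarith

/-- Moderate deviations, lower bound. -/
theorem gaussian_le_stable_left_tail {α : ℝ} (h1 : 1 < α) (h2 : α < 2)
    {μ : Measure ℝ} [IsProbabilityMeasure μ]
    (hμ : ∀ t : ℝ, charFun μ t = Complex.exp (stableExponent α t)) {y : ℝ}
    (hy1 : 2 / Real.sqrt (2 - α) ≤ y) (hy2 : y ≤ 2 / (2 - α)) :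
    Real.exp (-1) * (10 : ℝ) ^ (-2 : ℤ) * Real.exp (-(2 - α) * y ^ 2) ≤
      μ.real (Set.Iic (-(1 / 24) * y - 1 / (α - 1))) := by
  have hd : 0 < 2 - α := by linarith
  have ha : 0 < α - 1 := by linarith
  have h3 : 0 < 3 - α := by linarith
  have hsqrt : 0 < Real.sqrt (2 - α) := Real.sqrt_pos.mpr hd
  have hy : 0 < y := (div_pos two_pos hsqrt).trans_le hy1
  have hs : 0 < (2 - α) * y := mul_pos hd hy
  have hs2 : (2 - α) * y ≤ 2 := by
    rw [le_div_iff₀ hd] at hy2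
    linarith
  have hq : 4 ≤ (2 - α) * y ^ 2 := by
    rw [div_le_iff₀ hsqrt] at hy1
    have := Real.sq_sqrt hd.le
    nlinarith
  obtain ⟨hi₁, hl₁⟩ := integrable_exp_and_integral_exp_of_charFun_stable h1 h2 hμ hs
  obtain ⟨hi₂, hl₂⟩ := integrable_exp_and_integral_exp_of_charFun_stable h1 h2 hμ
    (mul_pos two_pos hs)
  have hψ := le_realLaplaceExponent h1 h2 hs.le
  have e1 : ((2 - α) * y) ^ 2 / 2 / (2 - α) = (2 - α) * y ^ 2 / 2 := by
    field_simp
  have hα : 1 / α ≤ 1 := by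
    rw [div_le_one (by linarith)]
    exact h1.le
  -- With `s ≤ 2`, `s(2-α) ≤ 4 - 2α ≤ 3 - α`: the cubic error costs at most a third of the quadratic
  -- term.
  have hcube : ((2 - α) * y) ^ 3 / 6 / (3 - α) ≤ (2 - α) * y ^ 2 / 6 := by
    rw [div_le_iff₀ h3]
    have hδ : (2 - α) * y * (2 - α) ≤ 3 - α := by nlinarith
    nlinarith [mul_le_mul_of_nonneg_left hδ (by positivity : 0 ≤ (2 - α) * y ^ 2)]
  -- With `q = (2-α)y²`, what is needed is `q/2 - q/6 - 1 ≥ q/24 + 1/6`, which is exactly `q ≥ 4`;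
  -- hence `c = 1/6`.
  have hw : (2 - α) * y * (1 / 24 * y + 1 / (α - 1)) + 1 / 6 ≤
      realLaplaceExponent α ((2 - α) * y) := by
    have e2 : (2 - α) * y * (1 / 24 * y + 1 / (α - 1)) =
        (2 - α) * y ^ 2 / 24 + (2 - α) * y / (α - 1) := by ring
    rw [e1, neg_div, neg_div] at hψ
    rw [e2]
    linarith
  have h := le_measureReal_Iic_neg hs (by norm_num) hi₁ hl₁ hi₂ hl₂ hw
  rw [show -(1 / 24 * y + 1 / (α - 1)) = -(1 / 24) * y - 1 / (α - 1) by ring] at h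
  refine le_trans ?_ h
  have hdiff := realLaplaceExponent_two_mul_sub_le h1 h2 hs.le
  rw [show ((2 - α) * y) ^ 2 / (2 - α) = (2 - α) * y ^ 2 by field_simp] at hdiff
  have hexp : Real.exp (-1) * Real.exp (-(2 - α) * y ^ 2) ≤
      Real.exp (-(realLaplaceExponent α (2 * ((2 - α) * y)) -
        2 * realLaplaceExponent α ((2 - α) * y))) := by
    rw [← Real.exp_add]
    exact Real.exp_le_exp.mpr (by linarith)
  have hten : (10 : ℝ) ^ (-2 : ℤ) ≤ (1 - Real.exp (-(1 / 6))) ^ 2 := by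
    have := exp_neg_le_one_sub_add_sq (by norm_num : (0 : ℝ) ≤ 1 / 6)
    have h10 : (1 / 10 : ℝ) ≤ 1 - Real.exp (-(1 / 6)) := by
      norm_num at this ⊢
      linarith
    calc (10 : ℝ) ^ (-2 : ℤ) = (1 / 10) ^ 2 := by norm_num
      _ ≤ _ := pow_le_pow_left₀ (by norm_num) h10 2
  calc _ = (10 : ℝ) ^ (-2 : ℤ) * (Real.exp (-1) * Real.exp (-(2 - α) * y ^ 2)) := by ring
    _ ≤ _ := mul_le_mul hten hexp (by positivity) (by positivity)

/-! ### Large deviations: numerical constants and the saddle point. -/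

theorem nine_fifths_le_sqrt : 9 / 5 ≤ Real.sqrt (4 - 2 / Real.exp 1) := by
  refine Real.le_sqrt_of_sq_le ?_
  have he := Real.exp_one_gt_d9
  have : 2 / Real.exp 1 ≤ 2 / 2.7182818283 := by gcongr
  norm_num at this ⊢
  linarith

theorem inv_exp_one_sub_le : 1 / Real.exp 1 - 1 / 4 ≤ 1 / 8 := by
  have he := Real.exp_one_gt_d9
  have : 1 / Real.exp 1 ≤ 1 / 2.7182818283 := by gcongr
  norm_num at this ⊢
  linarith

theorem exp_neg_one_le_one_sub_sq : Real.exp (-1) ≤ (1 - Real.exp (-1)) ^ 2 := by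
  have he := Real.exp_one_gt_d9
  have : Real.exp (-1) ≤ 0.3679 := by
    rw [Real.exp_neg, inv_le_comm₀ (Real.exp_pos 1) (by norm_num)]
    norm_num at he ⊢
    linarith
  nlinarith [Real.exp_pos (-1)]

/-- Bernoulli's inequality for the exponent `α - 1` in `[0, 1]`. -/
theorem two_rpow_le_two_mul {α : ℝ} (h1 : 1 < α) (h2 : α < 2) : (2 : ℝ) ^ α ≤ 2 + 2 * (α - 1) := by
  have hb := rpow_one_add_le_one_add_mul_self (by norm_num : (-1 : ℝ) ≤ 1)
    (by linarith : 0 ≤ α - 1) (by linarith : α - 1 ≤ 1)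
  have e : (2 : ℝ) ^ α = 2 * 2 ^ (α - 1) := by
    rw [← Real.rpow_one_add' zero_le_two (by linarith)]
    congr 1
    ring
  norm_num at hb
  rw [e]
  linarith

/-- The saddle point `(r / D)^{1/(α-1)}`. -/
theorem rpow_saddle_point {α r D : ℝ} (h1 : 1 < α) (hr : 0 < r) (hD : 0 < D) :
    ((r / D) ^ (1 / (α - 1))) ^ α = (r / D) ^ (1 / (α - 1)) * (r / D) ∧
      r ^ (α / (α - 1)) / D ^ (1 / (α - 1)) = r * (r / D) ^ (1 / (α - 1)) := by
  have ha : 0 < α - 1 := by linarith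
  have hp : α / (α - 1) = 1 + 1 / (α - 1) := by
    field_simp
    ring
  have hb : 0 < r / D := div_pos hr hD
  constructor
  · rw [← Real.rpow_mul hb.le, ← Real.rpow_add_one hb.ne', one_div_mul_eq_div, hp, add_comm]
  · rw [hp, Real.rpow_add hr, Real.rpow_one, mul_div_assoc, Real.div_rpow hr.le hD.le]

/-- The threshold condition at the saddle point. -/
theorem saddle_point_threshold {α y ν s κ : ℝ} (h1 : 1 < α) (h2 : α < 2) (hy : 2 ≤ y)
    (hν : 9 / 5 ≤ ν) (hs : 9 / 5 ≤ s)
    (hκ : 4 / 5 * ((1 / (2 - α) + 1 / (α - 1)) / α) ≤ κ) :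
    s * (y / 8 + 1 / (α - 1)) + 1 ≤
      κ * (s * (ν * (y + 1 / (α - 1)) / (1 / (2 - α) + 1 / (α - 1)))) := by
  have hd : 0 < 2 - α := by linarith
  have ha : 0 < α - 1 := by linarith
  have h0 : 0 < α := by linarith
  have hinv : 1 ≤ 1 / (α - 1) := by
    rw [le_div_iff₀ ha]
    linarith
  have hDpos : 0 < 1 / (2 - α) + 1 / (α - 1) := by positivity
  generalize 1 / (2 - α) + 1 / (α - 1) = D at *
  have eα : α * (1 / (α - 1)) = 1 + 1 / (α - 1) := by
    field_simp
    ring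
  generalize 1 / (α - 1) = j at *
  have hz : 0 < y + j := by linarith
  have hs0 : 0 < s := by linarith
  have hν0 : 0 < ν := by linarith
  have hlow : 4 / 5 * (D / α) * (s * (ν * (y + j) / D)) ≤ κ * (s * (ν * (y + j) / D)) := by
    gcongr
  refine le_trans ?_ hlow
  have e : 4 / 5 * (D / α) * (s * (ν * (y + j) / D)) = s * (4 / 5 * (ν * (y + j)) / α) := by
    field_simp
  -- The slack `5/9` becomes the required `1` after multiplication by `s ≥ 9/5`. Clearing `α` uses
  -- `αj = 1 + j`, and `y ≥ 2`, `j ≥ 1` suffice.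
  have hgap : y / 8 + j + 5 / 9 ≤ 4 / 5 * (ν * (y + j)) / α := by
    rw [le_div_iff₀ h0]
    have : α * (y / 8 + 5 / 9) ≤ 2 * (y / 8 + 5 / 9) := by gcongr
    have hνz : 9 / 5 * (y + j) ≤ ν * (y + j) := by gcongr
    linarith
  rw [e]
  have := mul_le_mul_of_nonneg_left hgap hs0.le
  linarith

/-- Large deviations, upper bound. -/
theorem stable_left_tail_le_exp_rpow {α : ℝ} (h1 : 1 < α) (h2 : α < 2)
    {μ : Measure ℝ} [IsProbabilityMeasure μ]
    (hμ : ∀ t : ℝ, charFun μ t = Complex.exp (stableExponent α t)) {z : ℝ} (hz : 0 < z) :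
    μ.real (Set.Iic (-z)) ≤
      Real.exp (-(((1 / 2) * z) ^ (α / (α - 1)) /
        (1 / (2 - α) + 1 / (α - 1)) ^ (1 / (α - 1)))) := by
  have hd : 0 < 2 - α := by linarith
  have ha : 0 < α - 1 := by linarith
  have h0 : 0 < α := by linarith
  have hDpos : 0 < 1 / (2 - α) + 1 / (α - 1) := by positivity
  have hκ := realLaplaceExponent_one_le h1 h2
  generalize 1 / (2 - α) + 1 / (α - 1) = D at *
  obtain ⟨hsα, htarget⟩ := rpow_saddle_point h1 hz hDpos
  have hs : 0 < (z / D) ^ (1 / (α - 1)) := Real.rpow_pos_of_pos (div_pos hz hDpos) _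
  rw [Real.mul_rpow (by norm_num) hz.le, mul_div_assoc, htarget]
  generalize (z / D) ^ (1 / (α - 1)) = s at *
  obtain ⟨hi, hl⟩ := integrable_exp_and_integral_exp_of_charFun_stable h1 h2 hμ hs
  refine (measureReal_Iic_neg_le_exp (w := z) hs hi hl).trans (Real.exp_le_exp.mpr ?_)
  -- Chernoff gives the exponent `-(1 - 1/α)zs`. With `p = α/(α-1)`, `1 - 1/α = 1/p ≥ 2^{-p}`, which
  -- is where the factor `1/2` in the base comes from.
  have hhalf : (1 / 2 : ℝ) ^ (α / (α - 1)) ≤ 1 - 1 / α := by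
    have h := self_le_two_rpow (p := α / (α - 1)) (by rw [le_div_iff₀ ha]; linarith)
    rw [one_div, Real.inv_rpow zero_le_two, show 1 - 1 / α = (α / (α - 1))⁻¹ by field_simp]
    exact inv_anti₀ (by positivity) h
  rw [realLaplaceExponent_eq_mul_rpow α hs, hsα]
  have hmul : realLaplaceExponent α 1 * (s * (z / D)) ≤ D / α * (s * (z / D)) := by
    gcongr
  have e : D / α * (s * (z / D)) = z * s * (1 / α) := by
    field_simp
  have := mul_le_mul_of_nonneg_right hhalf (mul_pos hz hs).le
  linarith

/-- Large deviations, lower bound. -/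
theorem exp_rpow_le_stable_left_tail {α : ℝ} (h1 : 1 < α) (h2 : α < 2)
    {μ : Measure ℝ} [IsProbabilityMeasure μ]
    (hμ : ∀ t : ℝ, charFun μ t = Complex.exp (stableExponent α t)) {y : ℝ}
    (hy : 2 / (2 - α) ≤ y) :
    Real.exp (-1) *
        Real.exp (-((Real.sqrt (4 - 2 / Real.exp 1) * (y + 1 / (α - 1))) ^ (α / (α - 1)) /
          (1 / (2 - α) + 1 / (α - 1)) ^ (1 / (α - 1)))) ≤
      μ.real (Set.Iic (-(1 / Real.exp 1 - 1 / 4) * y - 1 / (α - 1))) := by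
  have hd : 0 < 2 - α := by linarith
  have ha : 0 < α - 1 := by linarith
  have h0 : 0 < α := by linarith
  have hinv : 1 ≤ 1 / (α - 1) := by
    rw [le_div_iff₀ ha]
    linarith
  have hy2 : 2 ≤ y := by
    refine le_trans ?_ hy
    rw [le_div_iff₀ hd]
    linarith
  have hDpos : 0 < 1 / (2 - α) + 1 / (α - 1) := by positivity
  -- The range of `y` enters here: the saddle-point base is then at least `ν ≥ 9/5`, and raising it
  -- to a power `1/(α-1) ≥ 1` keeps `s ≥ 9/5`.
  have hDz : 1 / (2 - α) + 1 / (α - 1) ≤ y + 1 / (α - 1) := by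
    have : 1 / (2 - α) ≤ 2 / (2 - α) := by gcongr; norm_num
    linarith
  have hν := nine_fifths_le_sqrt
  have hthr : (1 / Real.exp 1 - 1 / 4) * y ≤ y / 8 := by
    have := mul_le_mul_of_nonneg_right inv_exp_one_sub_le (by linarith : 0 ≤ y)
    linarith
  rw [show -(1 / Real.exp 1 - 1 / 4) * y - 1 / (α - 1) =
    -((1 / Real.exp 1 - 1 / 4) * y + 1 / (α - 1)) by ring]
  generalize Real.sqrt (4 - 2 / Real.exp 1) = ν at *
  generalize (1 / Real.exp 1 - 1 / 4) * y = y' at *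
  have hκu := realLaplaceExponent_one_le h1 h2
  have hκl := le_realLaplaceExponent_one h1 h2
  have hthreshold := fun s (hs : 9 / 5 ≤ s) => saddle_point_threshold h1 h2 hy2 hν hs hκl
  have hκ0 : 0 ≤ realLaplaceExponent α 1 := le_trans (by positivity) hκl
  generalize 1 / (2 - α) + 1 / (α - 1) = D at *
  have hzpos : 0 < y + 1 / (α - 1) := by linarith
  have hbase : 9 / 5 ≤ ν * (y + 1 / (α - 1)) / D := by
    rw [le_div_iff₀ hDpos]
    exact mul_le_mul hν hDz hDpos.le (by linarith)
  have hνz : 0 < ν * (y + 1 / (α - 1)) := mul_pos (by linarith) hzpos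
  obtain ⟨hsα, htarget⟩ := rpow_saddle_point h1 hνz hDpos
  have hs95 : 9 / 5 ≤ (ν * (y + 1 / (α - 1)) / D) ^ (1 / (α - 1)) :=
    hbase.trans (Real.self_le_rpow_of_one_le (by linarith) hinv)
  rw [htarget]
  have hthreshold := hthreshold _ hs95
  generalize (ν * (y + 1 / (α - 1)) / D) ^ (1 / (α - 1)) = s at *
  have hs : 0 < s := by linarith
  obtain ⟨hi₁, hl₁⟩ := integrable_exp_and_integral_exp_of_charFun_stable h1 h2 hμ hs
  obtain ⟨hi₂, hl₂⟩ := integrable_exp_and_integral_exp_of_charFun_stable h1 h2 hμ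
    (mul_pos two_pos hs)
  have hψ := realLaplaceExponent_eq_mul_rpow α hs
  have hψ2 := realLaplaceExponent_eq_mul_rpow α (mul_pos two_pos hs)
  rw [Real.mul_rpow zero_le_two hs.le, hsα] at hψ2
  rw [hsα] at hψ
  have hw : s * (y' + 1 / (α - 1)) + 1 ≤ realLaplaceExponent α s := by
    rw [hψ]
    have := mul_le_mul_of_nonneg_left hthr hs.le
    linarith
  refine le_trans ?_ (le_measureReal_Iic_neg hs one_pos hi₁ hl₁ hi₂ hl₂ hw)
  -- By scaling the cost is `κ(2^α - 2)s^α`; `2^α - 2 ≤ 2(α-1)`, `κ ≤ D/α` and `2(α-1) ≤ α` reduce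
  -- it to the target exponent.
  have hcost : realLaplaceExponent α (2 * s) - 2 * realLaplaceExponent α s ≤
      ν * (y + 1 / (α - 1)) * s := by
    rw [hψ, hψ2]
    generalize ν * (y + 1 / (α - 1)) = r at *
    have hrD : 0 < s * (r / D) := mul_pos hs (div_pos hνz hDpos)
    calc realLaplaceExponent α 1 * (2 ^ α * (s * (r / D))) -
          2 * (realLaplaceExponent α 1 * (s * (r / D)))
        = realLaplaceExponent α 1 * ((2 ^ α - 2) * (s * (r / D))) := by ring
      _ ≤ realLaplaceExponent α 1 * (2 * (α - 1) * (s * (r / D))) := by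
          gcongr
          linarith [two_rpow_le_two_mul h1 h2]
      _ ≤ D / α * (2 * (α - 1) * (s * (r / D))) := by gcongr
      _ = 2 * (α - 1) / α * (r * s) := by field_simp
      _ ≤ 1 * (r * s) := by
          gcongr
          rw [div_le_one h0]
          linarith
      _ = _ := one_mul _
  exact mul_le_mul exp_neg_one_le_one_sub_sq (Real.exp_le_exp.mpr (by linarith))
    (Real.exp_pos _).le (sq_nonneg _)

/-! ### Transfer from the law of `X` to the four tail bounds. -/

theorem theorem15 {Ω : Type*} [MeasurableSpace Ω] (P : Measure Ω) [IsProbabilityMeasure P]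
    (α : ℝ) (hα : α ∈ Set.Ioo (1 : ℝ) 2) (X : Ω → ℝ) (hX : IsTotallyAsymmetricStable α X P) :
    (∀ y ∈ Set.Icc (2 / Real.sqrt (2 - α)) (2 / (2 - α)),
      P.real {ω | X ω ≤ -y - 1 / (α - 1)} ≤
          Real.exp (4 / 3) * Real.exp (-(1 / 2) * (2 - α) * y ^ 2) ∧
      P.real {ω | X ω ≤ -(1 / 24) * y - 1 / (α - 1)} ≥
          Real.exp (-1) * (10 : ℝ) ^ (-2 : ℤ) * Real.exp (-(2 - α) * y ^ 2)) ∧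
    (∀ y : ℝ, 2 / (2 - α) ≤ y →
      P.real {ω | X ω ≤ -y - 1 / (α - 1)} ≤
          Real.exp (-(((1 / 2) * (y + 1 / (α - 1))) ^ (α / (α - 1)) /
            (1 / (2 - α) + 1 / (α - 1)) ^ (1 / (α - 1)))) ∧
      P.real {ω | X ω ≤ -(1 / Real.exp 1 - 1 / 4) * y - 1 / (α - 1)} ≥
          Real.exp (-1) *
            Real.exp (-((Real.sqrt (4 - 2 / Real.exp 1) * (y + 1 / (α - 1))) ^ (α / (α - 1)) /
              (1 / (2 - α) + 1 / (α - 1)) ^ (1 / (α - 1))))) := by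
  obtain ⟨h1, h2⟩ := hα
  have hd : 0 < 2 - α := by linarith
  have ha : 0 < α - 1 := by linarith
  have := Measure.isProbabilityMeasure_map (μ := P) hX.aemeasurable
  have hlaw : ∀ a : ℝ, P.real {ω | X ω ≤ a} = (P.map X).real (Set.Iic a) := fun a => by
    rw [measureReal_def, measureReal_def,
      Measure.map_apply_of_aemeasurable hX.aemeasurable measurableSet_Iic]
    rfl
  have hμ := hX.charFun_eq
  simp only [hlaw]
  refine ⟨fun y hy => ⟨?_, gaussian_le_stable_left_tail h1 h2 hμ hy.1 hy.2⟩,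
    fun y hy => ⟨?_, exp_rpow_le_stable_left_tail h1 h2 hμ hy⟩⟩
  · have hy0 : 0 < y := (div_pos two_pos (Real.sqrt_pos.mpr hd)).trans_le hy.1
    -- The Gaussian upper bound holds with constant `1`, so the prefactor `e^{4/3}` is slack.
    refine (stable_left_tail_le_gaussian h1 h2 hμ hy0).trans
      (le_mul_of_one_le_left (Real.exp_pos _).le (Real.one_le_exp (by norm_num)))
  · have hy0 : 0 < y := (div_pos two_pos hd).trans_le hy
    rw [← neg_add']
    exact stable_left_tail_le_exp_rpow h1 h2 hμ (by positivity)
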